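/- Let $d\ge 2$ and $n\ge 1$ be integers and $\omega=e^{2\pi i/d}$. Consider $n$ qudits with computational bases $\{|q\rangle\}_{q\in\mathbb Z_d}$. For a set $e$ of qudits let $Z_e$ be the controlled phase gate $Z_e|x\rangle=\omega^{\prod_{i\in e}x_i}|x\rangle$, and let $|+\rangle=d^{-1/2}\sum_{q}|q\rangle$. A multi-hypergraph $H$ on $V=\{1,\dots,n\}$ assigns to each subset $e\subseteq V$ a multiplicity $m_e\in\mathbb Z_d$ with $m_\emptyset=0$; its hyperedges are the $e$ with $m_e\neq 0$, and its hypergraph state is $|H\rangle=\prod_e Z_e^{m_e}|+\rangle^{\otimes V}$. For $\mu\in\mathbb Z_d$ let $|G_\kappa^\mu\rangle=Z_{W}^{\mu}|+\rangle^{\otimes W}$, $|W|=\kappa$, be the elementary hypergraph state on $\kappa$ qudits. Suppose that $H$ is connected (any two vertices are joined by a chain of hyperedges, consecutive ones intersecting), let $k_{\max}$ be the largest cardinality of a hyperedge of $H$, and let $V=A\sqcup B$ be a bipartition with $A$ and $B$ non-empty. Then there is a finite adaptive protocol (each step may depend on earlier measurement outcomes), consisting only of single-qudit measurements in the $Z$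 (computational) basis and of unitaries $U_A\otimes U_B$ that are local with respect to $AB$, which transforms $|H\rangle$, for every sequence of measurement outcomes of nonzero probability, into a state of the form $$|G_\kappa^\mu\rangle\,|q_1\rangle|q_2\rangle\cdots|q_{n-\kappa}\rangle,\qquad 2\le\kappa\le k_{\max},\quad \mu\in\mathbb Z_d\setminus\{0\},$$ where $|G_\kappa^\mu\rangle$ occupies a set of $\kappa$ qudits that meets both $A$ and $B$ and each of the remaining $n-\kappa$ qudits is in a computational basis state $|q_i\rangle$. Here $\kappa$, $\mu$, the set of qudits and the $q_i$ may depend on the measurement outcomes. -/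

import Mathlib

open scoped BigOperators

noncomputable section

/-- A multi-hypergraph on the vertex set `V` for qudits of dimension `d`: every subset of `V`
carries a multiplicity in `ℤ/d`, and the hyperedges are the subsets with nonzero multiplicity.
Hyperedges are non-empty. -/
structure MultiHypergraph (d : ℕ) (V : Type*) where
  mult : Finset V → ZMod d
  mult_empty : mult ∅ = 0

namespace MultiHypergraph

variable {d : ℕ} {V : Type*}

/-- `e` is a hyperedge of `H`. -/
def IsEdge (H : MultiHypergraph d V) (e : Finset V) : Prop := H.mult e ≠ 0

/-- The graph in which two distinct vertices are adjacent when they share a hyperedge. -/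
def adjGraph (H : MultiHypergraph d V) : SimpleGraph V where
  Adj u v := u ≠ v ∧ ∃ e, H.IsEdge e ∧ u ∈ e ∧ v ∈ e
  symm := ⟨fun _ _ h => ⟨h.1.symm, h.2.imp fun _ he => ⟨he.1, he.2.2, he.2.1⟩⟩⟩
  loopless := ⟨fun _ h => h.1 rfl⟩

/-- Any two vertices are joined by a chain of hyperedges. -/
def IsConnected (H : MultiHypergraph d V) : Prop := H.adjGraph.Connected

open Classical in
/-- The largest cardinality of a hyperedge (`0` if there are no hyperedges). -/
def maxCard [Fintype V] (H : MultiHypergraph d V) : ℕ :=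
  (Finset.univ.filter fun e : Finset V => H.IsEdge e).sup Finset.card

end MultiHypergraph

namespace Qudit

/-- The Hilbert space of qudits of dimension `d` labelled by `V`; the computational basis is
indexed by the strings `V → ℤ/d`. -/
abbrev Space (d : ℕ) (V : Type*) := EuclideanSpace ℂ (V → ZMod d)

variable {d : ℕ} [NeZero d] {V : Type*} [Fintype V] [DecidableEq V]

/-- The linear operator given by a matrix in the computational basis, applied to a vector. -/
def act (M : Matrix (V → ZMod d) (V → ZMod d) ℂ) (ψ : Space d V) : Space d V :=
  Matrix.toEuclideanLin M ψ

/-- The vector `|+⟩^V`, all of whose amplitudes are `d^{-|V|/2}`. -/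
def plus (d : ℕ) [NeZero d] (V : Type*) [Fintype V] : Space d V :=
  WithLp.toLp 2 fun _ => ((Real.sqrt d : ℂ)⁻¹) ^ Fintype.card V

/-- The diagonal of the controlled phase gate `Z_e`: the entry at the string `x` is
`ω ^ (∏ i ∈ e, x i)` with `ω = exp (2πi/d)`. -/
def phase (e : Finset V) (x : V → ZMod d) : ℂ := ZMod.stdAddChar (∏ i ∈ e, x i)

/-- The hypergraph state `∏ₑ Z_e^{m_e} |+⟩^V`. The gates are diagonal, so that their product is the
diagonal operator whose diagonal is the pointwise product. -/
def hypergraphState (H : MultiHypergraph d V) : Space d V :=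
  act (Matrix.diagonal (∏ e : Finset V, phase e ^ (H.mult e).val)) (plus d V)

/-- The elementary hypergraph state `Z_V^μ |+⟩^V`, with the single hyperedge `V`. -/
def elementaryState (V : Type*) [Fintype V] [DecidableEq V] (μ : ZMod d) : Space d V :=
  act (Matrix.diagonal (phase Finset.univ ^ μ.val)) (plus d V)

/-- The product of a vector `φ` of the qudits in `e` with the computational basis
states `|q i⟩` of the qudits `i ∉ e`. -/
def tensorBasis (e : Finset V) (φ : Space d e) (q : V → ZMod d) : Space d V :=
  WithLp.toLp 2 fun x =>
    φ (fun i => x i) * ∏ i ∈ eᶜ, (if x i = q i then 1 else 0)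

/-- The set `e` of qudits is crossed by the bipartition with parts `A` and `Aᶜ`. -/
def Crosses (A e : Finset V) : Prop := (e ∩ A).Nonempty ∧ (e ∩ Aᶜ).Nonempty

/-- `U = U_A ⊗ U_B` for unitaries `U_A` on the qudits in `A` and `U_B` on those in `B = Aᶜ`. -/
def IsLocalUnitary (A : Finset V) (U : Matrix (V → ZMod d) (V → ZMod d) ℂ) : Prop :=
  ∃ UA ∈ Matrix.unitaryGroup ({i // i ∈ A} → ZMod d) ℂ,
  ∃ UB ∈ Matrix.unitaryGroup ({i // i ∈ Aᶜ} → ZMod d) ℂ,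
    ∀ x y : V → ZMod d,
      U x y = UA (fun i => x i) (fun i => y i) * UB (fun i => x i) (fun i => y i)

/-- The projector onto the subspace in which qudit `k` is in the basis state `|q⟩`. -/
def proj (k : V) (q : ZMod d) : Matrix (V → ZMod d) (V → ZMod d) ℂ :=
  Matrix.diagonal fun x => if x k = q then 1 else 0

/-- The normalized state after a measurement of qudit `k` in the `Z` basis with outcome `q`
(meaningful if the outcome has positive probability, `act (proj k q) ψ ≠ 0`). -/
def postMeasurement (k : V) (q : ZMod d) (ψ : Space d V) : Space d V :=
  ((‖act (proj k q) ψ‖⁻¹ : ℝ) : ℂ) • act (proj k q) ψ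

/-- `Reduces A T ψ`: some finite adaptive protocol, made of unitaries that are local with respect
to the bipartition with parts `A` and `Aᶜ` and of single-qudit measurements in the `Z` basis,
takes `ψ` to a state in `T`, whatever the outcomes of the measurements. Later steps may depend on
earlier outcomes. -/
inductive Reduces (A : Finset V) (T : Set (Space d V)) : Space d V → Prop
  | done (ψ : Space d V) : ψ ∈ T → Reduces A T ψ
  | unitary (ψ : Space d V) (U : Matrix (V → ZMod d) (V → ZMod d) ℂ) :
      IsLocalUnitary A U → Reduces A T (act U ψ) → Reduces A T ψ
  | measure (ψ : Space d V) (k : V) :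
      (∀ q : ZMod d, act (proj k q) ψ ≠ 0 → Reduces A T (postMeasurement k q ψ)) →
      Reduces A T ψ

/-- The states `|G_κ^μ⟩ |q₁⟩ ⋯ |q_{n-κ}⟩` with `2 ≤ κ ≤ K` and `μ ≠ 0`, where the elementary
hypergraph state occupies a set of `κ` qudits crossed by the bipartition. -/
def elementaryTargets (A : Finset V) (K : ℕ) : Set (Space d V) :=
  {ψ | ∃ (κ : ℕ) (μ : ZMod d) (e : Finset V) (q : V → ZMod d),
    2 ≤ κ ∧ κ ≤ K ∧ μ ≠ 0 ∧ e.card = κ ∧ Crosses A e ∧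
      ψ = tensorBasis e (elementaryState {i // i ∈ e} μ) q}

end Qudit

end

noncomputable section

/-! Every state of the protocol is a `phaseState`: the phase is a multilinear polynomial over `ZMod
d` in the active qudits `S`, the rest being in basis states. A shift of qudit `v` substitutes `x v +
c` for `x v`, a `Z` measurement substitutes a constant, and diagonal local unitaries remove
monomials supported on one side of the bipartition. Substitutions only move coefficients to smaller
sets, so the bound on crossing hyperedges persists.

`reduces_multilinear` keeps a crossing hyperedge alive until `S` is the only one. If `S` and a
crossing facet `S.erase v` are both hyperedges, either a shift of `v` cancels the facet, or no
outcome of measuring `v` does. Without such a facet, take a maximal crossing hyperedge `g ≠ S`: any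
`v ∈ S` outside `g` can be measured without changing the coefficient of `g`. -/

namespace Qudit

variable {d : ℕ} {V : Type*} [Fintype V] [DecidableEq V]

/-! ### Multilinear polynomials under substitution -/

/-- The multilinear polynomial with coefficient `m e` at the monomial `∏ i ∈ e, x i`. -/
def multilinear (m : Finset V → ZMod d) (x : V → ZMod d) : ZMod d :=
  ∑ e : Finset V, m e * ∏ i ∈ e, x i

/-- The coefficients of the polynomial obtained by the substitution `x v ↦ x v + c`. -/
def shiftCoeff (v : V) (c : ZMod d) (m : Finset V → ZMod d) (e : Finset V) : ZMod d :=
  if v ∈ e then m e else m e + c * m (insert v e)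

/-- The coefficients of the polynomial obtained by the substitution `x v ↦ r`. -/
def restrictCoeff (v : V) (r : ZMod d) (m : Finset V → ZMod d) (e : Finset V) : ZMod d :=
  if v ∈ e then 0 else m e + r * m (insert v e)

/-- Pairing `e` with `insert v e` exhibits the polynomial as affine in `x v`, so substitutions for
`x v` can be compared coefficientwise. -/
lemma multilinear_eq_sum_erase (m : Finset V → ZMod d) (x : V → ZMod d) (v : V) :
    multilinear m x =
      ∑ e ∈ (Finset.univ.erase v).powerset, (m e + x v * m (insert v e)) * ∏ i ∈ e, x i := by
  unfold multilinear
  have hu : (Finset.univ : Finset (Finset V)) = (insert v (Finset.univ.erase v)).powerset := by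
    rw [Finset.insert_erase (Finset.mem_univ v), Finset.powerset_univ]
  rw [hu, Finset.sum_powerset_insert (Finset.notMem_erase v _), ← Finset.sum_add_distrib]
  refine Finset.sum_congr rfl fun e he => ?_
  have hv : v ∉ e := fun h => Finset.notMem_erase v _ (Finset.mem_powerset.1 he h)
  rw [Finset.prod_insert hv]
  ring

lemma multilinear_add_single (m : Finset V → ZMod d) (x : V → ZMod d) (v : V) (c : ZMod d) :
    multilinear m (x + Pi.single v c) = multilinear (shiftCoeff v c m) x := by
  rw [multilinear_eq_sum_erase m _ v, multilinear_eq_sum_erase _ x v]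
  refine Finset.sum_congr rfl fun e he => ?_
  have hv : v ∉ e := fun h => Finset.notMem_erase v _ (Finset.mem_powerset.1 he h)
  have hp : ∏ i ∈ e, (x + Pi.single v c : V → ZMod d) i = ∏ i ∈ e, x i :=
    Finset.prod_congr rfl fun i hi => by
      have : i ≠ v := fun h => hv (h ▸ hi)
      simp [this]
  rw [hp]
  simp only [shiftCoeff, hv, if_false, Finset.mem_insert_self, if_true, Pi.add_apply,
    Pi.single_eq_same]
  ring

lemma multilinear_restrictCoeff (m : Finset V → ZMod d) (x : V → ZMod d) (v : V) :
    multilinear (restrictCoeff v (x v) m) x = multilinear m x := by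
  rw [multilinear_eq_sum_erase _ _ v, multilinear_eq_sum_erase _ _ v]
  refine Finset.sum_congr rfl fun e he => ?_
  have hv : v ∉ e := fun h => Finset.notMem_erase v _ (Finset.mem_powerset.1 he h)
  simp [restrictCoeff, hv]

variable [NeZero d]

/-! ### States with polynomial phases and their measurement -/

/-- The state with phase function `F` on the qudits in `S`, the others being in the basis states
`|q i⟩`. -/
def phaseState (S : Finset V) (F : (V → ZMod d) → ZMod d) (q : V → ZMod d) : Space d V :=
  WithLp.toLp 2 fun x => ((Real.sqrt d : ℂ)⁻¹) ^ S.card * ZMod.stdAddChar (F x) *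
    if ∀ i ∉ S, x i = q i then 1 else 0

lemma phaseState_congr (S : Finset V) {F G : (V → ZMod d) → ZMod d} (q : V → ZMod d)
    (h : ∀ x, (∀ i ∉ S, x i = q i) → F x = G x) : phaseState S F q = phaseState S G q := by
  ext x
  by_cases hx : ∀ i ∉ S, x i = q i
  · simp [phaseState, h x hx]
  · simp [phaseState, hx]

lemma act_apply (M : Matrix (V → ZMod d) (V → ZMod d) ℂ) (ψ : Space d V) (x : V → ZMod d) :
    act M ψ x = ∑ y, M x y * ψ y := by
  simp [act, Matrix.toEuclideanLin, Matrix.toLpLin_apply, Matrix.mulVec, dotProduct]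

lemma act_diagonal_apply (D : (V → ZMod d) → ℂ) (ψ : Space d V) (x : V → ZMod d) :
    act (Matrix.diagonal D) ψ x = D x * ψ x := by
  rw [act_apply, Finset.sum_eq_single x] <;> simp +contextual [Matrix.diagonal, eq_comm]

lemma card_agree_off (S : Finset V) (q : V → ZMod d) :
    (Finset.univ.filter fun x : V → ZMod d => ∀ i ∉ S, x i = q i).card = d ^ S.card := by
  have : (Finset.univ.filter fun x : V → ZMod d => ∀ i ∉ S, x i = q i) =
      Fintype.piFinset fun i => if i ∈ S then Finset.univ else {q i} := by
    ext x
    simp only [Finset.mem_filter, Finset.mem_univ, true_and, Fintype.mem_piFinset]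
    refine forall_congr' fun i => ?_
    by_cases hi : i ∈ S <;> simp [hi]
  rw [this, Fintype.card_piFinset]
  have h : ∀ i : V, (if i ∈ S then (Finset.univ : Finset (ZMod d)) else {q i}).card =
      if i ∈ S then d else 1 := fun i => by
    by_cases hi : i ∈ S <;> simp [hi, ZMod.card]
  simp [h, Finset.prod_ite_mem]

lemma norm_phaseState (S : Finset V) (F : (V → ZMod d) → ZMod d) (q : V → ZMod d) :
    ‖phaseState S F q‖ = 1 := by
  have hd : (0 : ℝ) < d := Nat.cast_pos.2 (NeZero.pos d)
  rw [EuclideanSpace.norm_eq, Real.sqrt_eq_one]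
  have h : ∀ x, ‖phaseState S F q x‖ ^ 2 =
      if ∀ i ∉ S, x i = q i then ((d : ℝ)⁻¹) ^ S.card else 0 := fun x => by
    by_cases hx : ∀ i ∉ S, x i = q i
    · have hs : ‖(Real.sqrt d : ℂ)‖ = Real.sqrt d := by
        rw [Complex.norm_real, Real.norm_of_nonneg (Real.sqrt_nonneg _)]
      have hc : ‖phaseState S F q x‖ = ((Real.sqrt d)⁻¹) ^ S.card := by
        simp only [phaseState, if_pos hx, mul_one, norm_mul, norm_pow, norm_inv, hs,
          AddChar.norm_apply]
      rw [hc, if_pos hx, ← pow_mul, mul_comm, pow_mul, inv_pow, Real.sq_sqrt hd.le]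
    · simp [phaseState, hx]
  rw [Finset.sum_congr rfl fun x _ => h x, ← Finset.sum_filter, Finset.sum_const,
    card_agree_off, nsmul_eq_mul, Nat.cast_pow, ← mul_pow, mul_inv_cancel₀ hd.ne', one_pow]

/-- The scalar does not depend on `r`: the outcomes on an active qudit are equiprobable. -/
lemma act_proj_phaseState {S : Finset V} {v : V} (hv : v ∈ S) (F : (V → ZMod d) → ZMod d)
    (q : V → ZMod d) (r : ZMod d) :
    act (proj v r) (phaseState S F q) =
      (((Real.sqrt d)⁻¹ : ℝ) : ℂ) • phaseState (S.erase v) F (Function.update q v r) := by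
  ext x
  have hiff : (∀ i ∉ S.erase v, x i = Function.update q v r i) ↔
      x v = r ∧ ∀ i ∉ S, x i = q i := by
    constructor
    · refine fun h => ⟨by simpa using h v (Finset.notMem_erase v S), fun i hi => ?_⟩
      have hiv : i ≠ v := fun e => hi (e ▸ hv)
      simpa [hiv] using h i fun hi' => hi (Finset.mem_of_mem_erase hi')
    · rintro ⟨h1, h2⟩ i hi
      by_cases hiv : i = v
      · subst hiv; simpa using h1
      · simpa [hiv] using h2 i fun hi' => hi (Finset.mem_erase.2 ⟨hiv, hi'⟩)
  rw [proj, act_diagonal_apply]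
  simp only [phaseState, PiLp.smul_apply, smul_eq_mul]
  simp only [hiff]
  rw [← Finset.card_erase_add_one hv, pow_succ]
  by_cases h1 : x v = r <;> by_cases h2 : ∀ i ∉ S, x i = q i <;> simp [h1, h2]
  rw [if_pos h2, if_pos h2]
  ring

lemma postMeasurement_phaseState {S : Finset V} {v : V} (hv : v ∈ S)
    (F : (V → ZMod d) → ZMod d) (q : V → ZMod d) (r : ZMod d) :
    postMeasurement v r (phaseState S F q) =
      phaseState (S.erase v) F (Function.update q v r) := by
  have hd : (0 : ℝ) < Real.sqrt d := Real.sqrt_pos.2 (Nat.cast_pos.2 (NeZero.pos d))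
  rw [postMeasurement, act_proj_phaseState hv, norm_smul, norm_phaseState, smul_smul,
    Complex.norm_real, Real.norm_of_nonneg (inv_nonneg.2 hd.le), mul_one, inv_inv,
    ← Complex.ofReal_mul, mul_inv_cancel₀ hd.ne', Complex.ofReal_one, one_smul]

lemma postMeasurement_multilinear {S : Finset V} {v : V} (hv : v ∈ S)
    (m : Finset V → ZMod d) (q : V → ZMod d) (r : ZMod d) :
    postMeasurement v r (phaseState S (multilinear m) q) =
      phaseState (S.erase v) (multilinear (restrictCoeff v r m)) (Function.update q v r) := by
  rw [postMeasurement_phaseState hv]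
  refine phaseState_congr _ _ fun x hx => ?_
  have hr : x v = r := by simpa using hx v (Finset.notMem_erase v S)
  rw [← multilinear_restrictCoeff m x v, hr]

/-! ### Local unitaries: shifts and diagonal phases -/

/-- The shift operator `|x + t⟩ ↦ |x⟩`. -/
def shiftMatrix {ι : Type*} [Fintype ι] (t : ι → ZMod d) :
    Matrix (ι → ZMod d) (ι → ZMod d) ℂ :=
  fun x y => if y = x + t then 1 else 0

lemma shiftMatrix_mem_unitaryGroup {ι : Type*} [Fintype ι] [DecidableEq ι] (t : ι → ZMod d) :
    shiftMatrix t ∈ Matrix.unitaryGroup (ι → ZMod d) ℂ := by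
  rw [Matrix.mem_unitaryGroup_iff]
  ext x y
  simp [Matrix.mul_apply, shiftMatrix, Matrix.star_apply, Matrix.one_apply, eq_comm]

omit [NeZero d] in
lemma eq_iff_restrict_eq (A : Finset V) (x y : V → ZMod d) :
    x = y ↔ ((fun i : {i // i ∈ A} => x i) = fun i : {i // i ∈ A} => y i) ∧
      ((fun i : {i // i ∈ Aᶜ} => x i) = fun i : {i // i ∈ Aᶜ} => y i) := by
  constructor
  · rintro rfl; exact ⟨rfl, rfl⟩
  · rintro ⟨h1, h2⟩
    ext i
    by_cases hi : i ∈ A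
    · exact congrFun h1 ⟨i, hi⟩
    · exact congrFun h2 ⟨i, Finset.mem_compl.2 hi⟩

lemma isLocalUnitary_shiftMatrix (A : Finset V) (t : V → ZMod d) :
    IsLocalUnitary A (shiftMatrix t) := by
  refine ⟨shiftMatrix fun i => t i, shiftMatrix_mem_unitaryGroup _,
    shiftMatrix fun i => t i, shiftMatrix_mem_unitaryGroup _, fun x y => ?_⟩
  have h := eq_iff_restrict_eq A y (x + t)
  simp only [shiftMatrix, ite_zero_mul_ite_zero, mul_one]
  exact if_congr h rfl rfl

lemma act_shiftMatrix_apply (t : V → ZMod d) (ψ : Space d V) (x : V → ZMod d) :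
    act (shiftMatrix t) ψ x = ψ (x + t) := by
  simp [act_apply, shiftMatrix]

lemma act_shiftMatrix_multilinear {S : Finset V} {v : V} (hv : v ∈ S) (c : ZMod d)
    (m : Finset V → ZMod d) (q : V → ZMod d) :
    act (shiftMatrix (Pi.single v c)) (phaseState S (multilinear m) q) =
      phaseState S (multilinear (shiftCoeff v c m)) q := by
  ext x
  have hiff : (∀ i ∉ S, (x + Pi.single v c : V → ZMod d) i = q i) ↔ ∀ i ∉ S, x i = q i :=
    forall₂_congr fun i hi => by
      have : i ≠ v := fun h => hi (h ▸ hv)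
      simp [this]
  rw [act_shiftMatrix_apply]
  simp only [phaseState, hiff, multilinear_add_single]

lemma diagonal_stdAddChar_mem_unitaryGroup {ι : Type*} [Fintype ι] [DecidableEq ι]
    (a : ι → ZMod d) :
    Matrix.diagonal (fun x => (ZMod.stdAddChar (a x) : ℂ)) ∈ Matrix.unitaryGroup ι ℂ := by
  rw [Matrix.mem_unitaryGroup_iff, Matrix.star_eq_conjTranspose, Matrix.diagonal_conjTranspose,
    Matrix.diagonal_mul_diagonal, ← Matrix.diagonal_one]
  congr 1
  ext x
  rw [Pi.star_apply, Complex.star_def, Complex.mul_conj, Complex.normSq_eq_norm_sq,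
    AddChar.norm_apply]
  simp

lemma isLocalUnitary_diagonal (A : Finset V) (a : ({i // i ∈ A} → ZMod d) → ZMod d)
    (b : ({i // i ∈ Aᶜ} → ZMod d) → ZMod d) :
    IsLocalUnitary A (Matrix.diagonal fun x : V → ZMod d =>
      (ZMod.stdAddChar (a (fun i => x i) + b (fun i => x i)) : ℂ)) := by
  refine ⟨Matrix.diagonal fun y => ZMod.stdAddChar (a y), diagonal_stdAddChar_mem_unitaryGroup a,
    Matrix.diagonal fun y => ZMod.stdAddChar (b y), diagonal_stdAddChar_mem_unitaryGroup b,
    fun x y => ?_⟩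
  have h := eq_iff_restrict_eq A x y
  by_cases hxy : x = y
  · subst hxy; simp [AddChar.map_add_eq_mul]
  · rw [Matrix.diagonal_apply_ne _ hxy]
    rw [h, not_and_or] at hxy
    rcases hxy with h1 | h1
    · rw [Matrix.diagonal_apply_ne _ h1, zero_mul]
    · rw [Matrix.diagonal_apply_ne _ h1, mul_zero]

/-- The string that agrees with `y` on `A` and vanishes elsewhere. -/
def extendZero (A : Finset V) (y : {i // i ∈ A} → ZMod d) (i : V) : ZMod d :=
  if h : i ∈ A then y ⟨i, h⟩ else 0

-- This lets a polynomial on `V` with monomials inside `A` define a diagonal gate on the qudits of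
-- `A` alone.
omit [NeZero d] in
lemma multilinear_extendZero (A : Finset V) (m : Finset V → ZMod d)
    (hm : ∀ e, m e ≠ 0 → e ⊆ A) (x : V → ZMod d) :
    multilinear m (extendZero A fun i => x i) = multilinear m x := by
  refine Finset.sum_congr rfl fun e _ => ?_
  by_cases he : m e = 0
  · simp [he]
  · congr 1
    exact Finset.prod_congr rfl fun i hi => by simp [extendZero, hm e he hi]

/-! ### Crossing sets and the reduction -/

lemma crosses_or_subset (A e : Finset V) : Crosses A e ∨ e ⊆ A ∨ e ⊆ Aᶜ := by
  by_contra! h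
  obtain ⟨h1, h2, h3⟩ := h
  obtain ⟨i, hi, hiA⟩ := Finset.not_subset.1 h2
  obtain ⟨j, hj, hjA⟩ := Finset.not_subset.1 h3
  rw [Finset.mem_compl, not_not] at hjA
  exact h1 ⟨⟨j, Finset.mem_inter.2 ⟨hj, hjA⟩⟩,
    ⟨i, Finset.mem_inter.2 ⟨hi, Finset.mem_compl.2 hiA⟩⟩⟩

lemma Crosses.mono {A e f : Finset V} (h : Crosses A e) (hef : e ⊆ f) : Crosses A f :=
  ⟨h.1.mono (Finset.inter_subset_inter_right hef), h.2.mono (Finset.inter_subset_inter_right hef)⟩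

lemma Crosses.two_le_card {A e : Finset V} (h : Crosses A e) : 2 ≤ e.card := by
  obtain ⟨⟨i, hi⟩, ⟨j, hj⟩⟩ := h
  rw [Finset.mem_inter] at hi hj
  refine Finset.one_lt_card.2 ⟨i, hi.1, j, hj.1, ?_⟩
  rintro rfl
  exact Finset.mem_compl.1 hj.2 hi.2

lemma Crosses.not_subset_compl {A e : Finset V} (h : Crosses A e) : ¬ e ⊆ Aᶜ := by
  obtain ⟨i, hi⟩ := h.1
  rw [Finset.mem_inter] at hi
  exact fun he => Finset.mem_compl.1 (he hi.1) hi.2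

lemma Crosses.not_subset {A e : Finset V} (h : Crosses A e) : ¬ e ⊆ A := by
  obtain ⟨i, hi⟩ := h.2
  rw [Finset.mem_inter] at hi
  exact fun he => Finset.mem_compl.1 hi.2 (he hi.1)

lemma tensorBasis_elementaryState (S : Finset V) (μ : ZMod d) (q : V → ZMod d) :
    tensorBasis S (elementaryState {i // i ∈ S} μ) q =
      phaseState S (fun x => μ * ∏ i ∈ S, x i) q := by
  ext x
  have hphase : ∀ y : ZMod d, (ZMod.stdAddChar y : ℂ) ^ μ.val = ZMod.stdAddChar (μ * y) :=
    fun y => by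
      rw [← AddChar.map_nsmul_eq_pow, nsmul_eq_mul, ZMod.natCast_zmod_val]
  have hp : ∏ i : {i // i ∈ S}, x i = ∏ i ∈ S, x i := Finset.prod_coe_sort S x
  have hind : (∏ i ∈ Sᶜ, if x i = q i then (1 : ℂ) else 0) =
      if ∀ i ∉ S, x i = q i then 1 else 0 := by
    rw [Finset.prod_ite_zero]
    simp
  simp only [tensorBasis, elementaryState, act_diagonal_apply, phaseState, plus, Pi.pow_apply,
    phase, hphase, hp, hind, Fintype.card_coe]
  ring

/-- A state whose only hyperedge crossed by the bipartition is the set of all its active qudits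
is local-unitarily equivalent to an elementary state. -/
lemma reduces_of_unique_crossing {A S : Finset V} {K : ℕ} {m : Finset V → ZMod d}
    (q : V → ZMod d) (hS : Crosses A S) (hK : S.card ≤ K) (hm : m S ≠ 0)
    (huniq : ∀ e, m e ≠ 0 → Crosses A e → e = S) :
    Reduces A (elementaryTargets A K) (phaseState S (multilinear m) q) := by
  set mA : Finset V → ZMod d := fun e => if e ⊆ A then m e else 0 with hmA
  -- The empty set lies in both `A` and `Aᶜ`; testing `e ⊆ A` again here keeps the constant term
  -- from being counted twice.
  set mB : Finset V → ZMod d := fun e => if e ⊆ A then 0 else if e ⊆ Aᶜ then m e else 0 with hmB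
  have hA : ∀ e, mA e ≠ 0 → e ⊆ A := fun e h => by
    by_contra h'; simp [hmA, h'] at h
  have hB : ∀ e, mB e ≠ 0 → e ⊆ Aᶜ := fun e h => by
    by_contra h'; simp [hmB, h'] at h
  have hsplit : ∀ x : V → ZMod d,
      multilinear m x = m S * ∏ i ∈ S, x i + multilinear mA x + multilinear mB x := fun x => by
    have h1 : m S * ∏ i ∈ S, x i =
        ∑ e : Finset V, (if e = S then m e else 0) * ∏ i ∈ e, x i := by simp
    rw [h1]
    unfold multilinear
    rw [← Finset.sum_add_distrib, ← Finset.sum_add_distrib]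
    refine Finset.sum_congr rfl fun e _ => ?_
    rw [← add_mul, ← add_mul]
    congr 1
    by_cases heS : e = S
    · subst heS; simp [hmA, hmB, hS.not_subset, hS.not_subset_compl]
    · by_cases heA : e ⊆ A
      · simp [hmA, hmB, heS, heA]
      · by_cases heB : e ⊆ Aᶜ
        · simp [hmA, hmB, heS, heA, heB]
        · have : m e = 0 := by
            by_contra h
            rcases crosses_or_subset A e with h' | h' | h'
            exacts [heS (huniq e h h'), heA h', heB h']
          simp [hmA, hmB, this]
  refine Reduces.unitary _ _ (isLocalUnitary_diagonal A
    (fun y => -multilinear mA (extendZero A y)) fun y => -multilinear mB (extendZero Aᶜ y)) ?_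
  refine Reduces.done _ ⟨S.card, m S, S, q, hS.two_le_card, hK, hm, rfl, hS, ?_⟩
  rw [tensorBasis_elementaryState]
  ext x
  rw [act_diagonal_apply]
  simp only [phaseState, multilinear_extendZero _ _ hA, multilinear_extendZero _ _ hB, hsplit x]
  have hx : m S * ∏ i ∈ S, x i = (-multilinear mA x + -multilinear mB x) +
      (m S * ∏ i ∈ S, x i + multilinear mA x + multilinear mB x) := by ring
  conv_rhs => rw [hx, AddChar.map_add_eq_mul]
  ring

open Classical in
/-- The active qudits `v` for which all active qudits but `v` form a hyperedge crossed by the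
bipartition. -/
def crossingFacets (A S : Finset V) (m : Finset V → ZMod d) : Finset V :=
  S.filter fun v => Crosses A (S.erase v) ∧ m (S.erase v) ≠ 0

omit [NeZero d] in
lemma mem_crossingFacets {A S : Finset V} {m : Finset V → ZMod d} {v : V} :
    v ∈ crossingFacets A S m ↔ v ∈ S ∧ Crosses A (S.erase v) ∧ m (S.erase v) ≠ 0 := by
  simp [crossingFacets]

-- A shift of `v` alters only coefficients of sets avoiding `v`. Among the facets of `S` this is
-- `S.erase v` alone, which is cancelled, so no new facet appears.
omit [NeZero d] in
lemma crossingFacets_shiftCoeff_ssubset {A S : Finset V} {m : Finset V → ZMod d} {v : V}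
    (hv : v ∈ crossingFacets A S m) {c : ZMod d} (hc : m (S.erase v) + c * m S = 0) :
    crossingFacets A S (shiftCoeff v c m) ⊂ crossingFacets A S m := by
  have hvS := (mem_crossingFacets.1 hv).1
  have hnot : v ∉ crossingFacets A S (shiftCoeff v c m) := fun h => by
    have := (mem_crossingFacets.1 h).2.2
    simp [shiftCoeff, Finset.insert_erase hvS, hc] at this
  refine (Finset.ssubset_iff_of_subset fun w hw => ?_).2 ⟨v, hv, hnot⟩
  have hwv : v ≠ w := fun h => hnot (h ▸ hw)
  have hw' := mem_crossingFacets.1 hw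
  simpa [mem_crossingFacets, shiftCoeff, hwv, hvS] using hw'

omit [NeZero d] in
/-- Substitution does not enlarge the hyperedges. -/
lemma exists_superset_of_ne_zero {v : V} {r : ZMod d} {m m' : Finset V → ZMod d}
    (hm' : m' = shiftCoeff v r m ∨ m' = restrictCoeff v r m) {e : Finset V} (he : m' e ≠ 0) :
    ∃ f, e ⊆ f ∧ m f ≠ 0 := by
  by_contra! h
  have h1 := h e subset_rfl
  have h2 := h (insert v e) (Finset.subset_insert v e)
  rcases hm' with rfl | rfl
  · simp [shiftCoeff, h1, h2] at he
  · simp [restrictCoeff, h1, h2] at he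

/-- A state with a hyperedge crossed by the bipartition reduces to an elementary state. -/
theorem reduces_multilinear (A : Finset V) (K : ℕ) (S : Finset V) (m : Finset V → ZMod d)
    (q : V → ZMod d) (hsupp : ∀ e, m e ≠ 0 → e ⊆ S)
    (hK : ∀ e, m e ≠ 0 → Crosses A e → e.card ≤ K) (hex : ∃ e, m e ≠ 0 ∧ Crosses A e) :
    Reduces A (elementaryTargets A K) (phaseState S (multilinear m) q) := by
  -- Measuring `v` is safe once a crossing hyperedge survives every outcome; the recursion then has
  -- fewer active qudits.
  have hmeasure : ∀ v ∈ S,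
      (∀ r, ∃ e, restrictCoeff v r m e ≠ 0 ∧ Crosses A e) →
      Reduces A (elementaryTargets A K) (phaseState S (multilinear m) q) := by
    intro v hv h
    refine Reduces.measure _ v fun r _ => ?_
    rw [postMeasurement_multilinear hv]
    refine reduces_multilinear A K (S.erase v) (restrictCoeff v r m) _ (fun e he => ?_)
      (fun e he hc => ?_) (h r)
    · obtain ⟨f, hef, hf⟩ := exists_superset_of_ne_zero (Or.inr rfl) he
      refine Finset.subset_erase.2 ⟨hef.trans (hsupp f hf), fun hve => ?_⟩
      simp [restrictCoeff, hve] at he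
    · obtain ⟨f, hef, hf⟩ := exists_superset_of_ne_zero (Or.inr rfl) he
      exact (Finset.card_le_card hef).trans (hK f hf (hc.mono hef))
  by_cases hfacet : m S ≠ 0 ∧ (crossingFacets A S m).Nonempty
  · obtain ⟨_, v, hv⟩ := hfacet
    obtain ⟨hvS, hcross, hne⟩ := mem_crossingFacets.1 hv
    -- For composite `d`, `m S` may fail to be invertible, so a cancelling shift need not exist.
    by_cases hc : ∃ c, m (S.erase v) + c * m S = 0
    · obtain ⟨c, hc⟩ := hc
      refine Reduces.unitary _ _ (isLocalUnitary_shiftMatrix A (Pi.single v c)) ?_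
      rw [act_shiftMatrix_multilinear hvS]
      refine reduces_multilinear A K S (shiftCoeff v c m) q (fun e he => ?_)
        (fun e he hc => ?_) ⟨S, by simpa [shiftCoeff, hvS], hcross.mono (S.erase_subset v)⟩
      · obtain ⟨f, hef, hf⟩ := exists_superset_of_ne_zero (Or.inl rfl) he
        exact hef.trans (hsupp f hf)
      · obtain ⟨f, hef, hf⟩ := exists_superset_of_ne_zero (Or.inl rfl) he
        exact (Finset.card_le_card hef).trans (hK f hf (hc.mono hef))
    · push Not at hc
      -- After outcome `r` the coefficient of `S.erase v` is `m (S.erase v) + r * m S`, which `hc`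
      -- keeps nonzero.
      exact hmeasure v hvS fun r =>
        ⟨S.erase v, by simpa [restrictCoeff, Finset.insert_erase hvS] using hc r, hcross⟩
  by_cases huniq : ∀ e, m e ≠ 0 → Crosses A e → e = S
  · obtain ⟨e, he, hce⟩ := hex
    obtain rfl := huniq e he hce
    exact reduces_of_unique_crossing q hce (hK e he hce) he huniq
  · push Not at huniq
    obtain ⟨g, hg⟩ := (Set.toFinite {e | m e ≠ 0 ∧ Crosses A e ∧ e ≠ S}).exists_maximal
      (by obtain ⟨e, he⟩ := huniq; exact ⟨e, he⟩)
    obtain ⟨hgm, hgc, hgS⟩ := hg.prop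
    obtain ⟨v, hvS, hvg⟩ := Finset.exists_of_ssubset ((hsupp g hgm).ssubset_of_ne hgS)
    -- Otherwise `insert v g` either equals `S`, making `g` an excluded crossing facet, or
    -- contradicts the maximality of `g`.
    have hzero : m (insert v g) = 0 := by
      by_contra hne
      by_cases hins : insert v g = S
      · refine hfacet ⟨hins ▸ hne, v, mem_crossingFacets.2 ?_⟩
        rw [← hins, Finset.erase_insert hvg]
        exact ⟨Finset.mem_insert_self v g, hgc, hgm⟩
      · exact hvg (hg.le_of_ge ⟨hne, hgc.mono (Finset.subset_insert v g), hins⟩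
          (Finset.subset_insert v g) (Finset.mem_insert_self v g))
    exact hmeasure v hvS fun r => ⟨g, by simpa [restrictCoeff, hvg, hzero] using hgm, hgc⟩
termination_by (S.card, (crossingFacets A S m).card)
decreasing_by
  · exact Prod.Lex.left _ _ (Finset.card_erase_lt_of_mem hv)
  · exact Prod.Lex.right _ (Finset.card_lt_card (crossingFacets_shiftCoeff_ssubset hv hc))

/-! ### Hypergraph states and connectivity -/

lemma stdAddChar_sum {ι : Type*} (s : Finset ι) (f : ι → ZMod d) :
    (ZMod.stdAddChar (∑ i ∈ s, f i) : ℂ) = ∏ i ∈ s, ZMod.stdAddChar (f i) := by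
  classical
  induction s using Finset.induction_on with
  | empty => simp
  | insert i s hi ih =>
    rw [Finset.sum_insert hi, Finset.prod_insert hi, AddChar.map_add_eq_mul, ih]

/-- All qudits are active, so `q` is arbitrary. -/
lemma hypergraphState_eq_phaseState (H : MultiHypergraph d V) (q : V → ZMod d) :
    hypergraphState H = phaseState Finset.univ (multilinear H.mult) q := by
  ext x
  have h : (∏ e : Finset V, phase e ^ (H.mult e).val) x =
      (ZMod.stdAddChar (multilinear H.mult x) : ℂ) := by
    rw [Finset.prod_apply, multilinear, stdAddChar_sum]
    refine Finset.prod_congr rfl fun e _ => ?_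
    rw [Pi.pow_apply, phase, ← AddChar.map_nsmul_eq_pow, nsmul_eq_mul, ZMod.natCast_zmod_val]
  rw [hypergraphState, act_diagonal_apply, h]
  simp [plus, phaseState, mul_comm]

end Qudit

namespace MultiHypergraph

/-- A walk from `A` to `Aᶜ` has a step leaving `A`; a hyperedge shared by the ends of that step
crosses. -/
lemma IsConnected.exists_crossing_edge {d : ℕ} {V : Type*} [Fintype V] [DecidableEq V]
    {H : MultiHypergraph d V} (hH : H.IsConnected) {A : Finset V} (hA : A.Nonempty)
    (hB : Aᶜ.Nonempty) : ∃ e, H.IsEdge e ∧ Qudit.Crosses A e := by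
  obtain ⟨a, ha⟩ := hA
  obtain ⟨b, hb⟩ := hB
  obtain ⟨w⟩ := hH.preconnected a b
  obtain ⟨p, -, h1, h2⟩ := w.exists_boundary_dart (A : Set V) ha
    (by simpa using hb)
  obtain ⟨-, e, he, hu, hv⟩ := p.adj
  exact ⟨e, he, ⟨_, Finset.mem_inter.2 ⟨hu, h1⟩⟩,
    ⟨_, Finset.mem_inter.2 ⟨hv, Finset.mem_compl.2 h2⟩⟩⟩

lemma IsEdge.card_le_maxCard {d : ℕ} {V : Type*} [Fintype V] {H : MultiHypergraph d V}
    {e : Finset V} (he : H.IsEdge e) : e.card ≤ H.maxCard := by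
  classical
  exact Finset.le_sup (f := Finset.card) (by simpa using he)

end MultiHypergraph

end

theorem mainTheorem4 (d n : ℕ) [NeZero d] (hd : 2 ≤ d)
    (H : MultiHypergraph d (Fin n)) (hH : H.IsConnected)
    (A : Finset (Fin n)) (hA : A.Nonempty) (hB : Aᶜ.Nonempty) :
    Qudit.Reduces A (Qudit.elementaryTargets A H.maxCard) (Qudit.hypergraphState H) := by
  rw [Qudit.hypergraphState_eq_phaseState H 0]
  exact Qudit.reduces_multilinear A _ _ _ _ (fun e _ => e.subset_univ)
    (fun e he _ => MultiHypergraph.IsEdge.card_le_maxCard he) (hH.exists_crossing_edge hA hB)
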